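/- Setting. Let $X$ be a finite data set with a symmetric similarity function $S:X\times X\to\mathbb R$, and for non-empty $A,B\subseteq X$ let $S(A,B)$ be the average of $S(x,y)$ over $x\in A$, $y\in B$. A clustering is a partition of $X$ into non-empty clusters. A clustering satisfies stability if for any two different clusters $C,D$ of it, every non-empty $A\subsetneq C$ and every non-empty $B\subseteq D$, $S(A,C\setminus A)>S(A,B)$. For a set $A$ and a clustering $\mathcal P$ put $\mathrm{dist}(A,\mathcal P)=|\{B\in\mathcal P: B\cap A\neq\emptyset\}|-1$, and $\mathrm{dist}(\mathcal Q,\mathcal P)=\sum_{A\in\mathcal Q}\mathrm{dist}(A,\mathcal P)$. Let $\mathcal C^*$ be the target clustering, with $k$ clusters, and $\mathcal C$ the initial clustering; its overclustering error is $\delta_o=\mathrm{dist}(\mathcal C,\mathcal C^*)$ and its underclustering error is $\delta_u=\mathrm{dist}(\mathcal C^*,\mathcal C)$. Algorithms. Let $T$ be an average-linkage tree of $X$: starting from the single points, two distinct current nodes $N_1,N_2$ with the largest $S(N_1,N_2)$ are joined repeatedly (ties broken arbitrarily) until one node is left. $\mathrm{Split}(C)$ finds the node of $T$, with children $N_1,N_2$,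 at which the points of $C$ are first split in two, and returns $N_1\cap C$ and $N_2\cap C$. A request to split a cluster $C$ is answered by replacing $C$ by the two parts $\mathrm{Split}(C)$. A request to merge clusters $C_i,C_j$ is answered by computing $\mathrm{Split}(C_i\cup C_j)=\{C_i',C_j'\}$ and replacing $C_i,C_j$ by $C_i\cup C_j$ if $\{C_i',C_j'\}=\{C_i,C_j\}$, and by $C_i',C_j'$ otherwise. Oracle (unrestricted-merge model with random merges). Starting from $\mathcal C$, as long as the current clustering is not $\mathcal C^*$, an oracle makes a request, possibly at random and depending on the whole history. It may request to split any cluster that contains points from two or more target clusters. A pair of distinct current clusters is a feasible merge if both contain a point of the same target cluster; conditionally on the history and on the next request being a merge request, that request is uniformly distributed over the feasible merges. The choice between a split and a merge request, and the choice of the split, are otherwise arbitrary. Theorem. There is an absolute constant $K>0$ such that the following holds. If $\mathcal C^*$ satisfies stability with respect to $S$, $0<\varepsilon<1$ and $k/\varepsilon\ge 2$, then for every such oracle, with probability at least $1-\varepsilon$ the clustering becomes $\mathcal C^*$ after at most $\delta_o$ split requests and at most $K\,\log(k/\varepsilon)\,\delta_u^2$ merge requests. -/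

import Mathlib

namespace InteractiveClustering

/-! A clustering of a finite data set `X` is a `Finpartition (Finset.univ : Finset X)`. The clusterings
that arise during the interaction are handled through their sets of clusters, of type
`Finset (Finset X)`. -/

section Basic

variable {X : Type*} [DecidableEq X]

/-- The average similarity `S(A, B)` of two finite sets of points. -/
noncomputable def avgSim (S : X → X → ℝ) (A B : Finset X) : ℝ :=
  (∑ x ∈ A, ∑ y ∈ B, S x y) / ((A.card : ℝ) * (B.card : ℝ))

/-- Stability of a clustering `P` with respect to the similarity function `S`: a non-empty proper
part `A` of a cluster `C` is on average more similar to the rest of `C` than to any non-empty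
part `B` of another cluster `D`. -/
def Stable (S : X → X → ℝ) (P : Finset (Finset X)) : Prop :=
  ∀ C ∈ P, ∀ D ∈ P, C ≠ D → ∀ A B : Finset X, A.Nonempty → A ⊂ C → B.Nonempty → B ⊆ D →
    avgSim S A B < avgSim S A (C \ A)

/-- `dist(A, P)`: the number of additional clusters of `P` that contain points of `A`. -/
def clusterDist (A : Finset X) (P : Finset (Finset X)) : ℕ :=
  (P.filter fun B => (B ∩ A).Nonempty).card - 1

/-- `dist(P, Q) = ∑_{A ∈ P} dist(A, Q)`. -/
def clusteringDist (P Q : Finset (Finset X)) : ℕ :=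
  ∑ A ∈ P, clusterDist A Q

/-- The overclustering error of the proposed clustering `P` for the target clustering. -/
def overclusteringError (P target : Finset (Finset X)) : ℕ :=
  clusteringDist P target

/-- The underclustering error of the proposed clustering `P` for the target clustering. -/
def underclusteringError (P target : Finset (Finset X)) : ℕ :=
  clusteringDist target P

end Basic

/-! ### The average-linkage tree -/

/-- Binary trees whose leaves are data points. -/
inductive LinkageTree (X : Type*) where
  | leaf (x : X) : LinkageTree X
  | node (l r : LinkageTree X) : LinkageTree X

section Tree

variable {X : Type*} [DecidableEq X]

/-- The points at the leaves below (the root of) a tree. -/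
def LinkageTree.points : LinkageTree X → Finset X
  | .leaf x => {x}
  | .node l r => l.points ∪ r.points

/-- One step of bottom-up average linkage on the set `F` of current (parentless) nodes: two distinct
current nodes whose average similarity is the largest one are merged, ties being broken
arbitrarily. -/
def LinkageStep (S : X → X → ℝ) (F F' : Set (LinkageTree X)) : Prop :=
  ∃ a ∈ F, ∃ b ∈ F, a ≠ b ∧
    (∀ c ∈ F, ∀ d ∈ F, c ≠ d → avgSim S c.points d.points ≤ avgSim S a.points b.points) ∧
    F' = insert (LinkageTree.node a b) (F \ {a, b})

/-- `T` is an average-linkage tree of the data set `X`: it is what is left when linkage steps,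
starting from the single points, have merged everything. -/
def IsAverageLinkageTree (S : X → X → ℝ) (T : LinkageTree X) : Prop :=
  Relation.ReflTransGen (LinkageStep S) (Set.range LinkageTree.leaf) {T}

/-- The split procedure: follow the points of `C` down the tree to the node at which they are first
split in two, and return the parts of `C` in its two children. (A set of at least two points of the
tree never ends up in a leaf.) -/
def LinkageTree.split : LinkageTree X → Finset X → Finset X × Finset X
  | .leaf _, C => (C, ∅)
  | .node l r, C =>
      if C ⊆ l.points then l.split C
      else if C ⊆ r.points then r.split C
      else (l.points ∩ C, r.points ∩ C)

end Tree

/-! ### Requests, their feasibility, and the algorithm's answers -/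

/-- An edit request: to split a cluster, or to merge the two clusters that form the (unordered)
pair `q`. -/
inductive Request (X : Type*) where
  | split (C : Finset X) : Request X
  | merge (q : Finset (Finset X)) : Request X

section Model

variable {X : Type*} [DecidableEq X]

/-- The clusters that may be split: those with points from two or more target clusters. -/
def feasibleSplits (target P : Finset (Finset X)) : Finset (Finset X) :=
  P.filter fun C => 2 ≤ (target.filter fun D => (D ∩ C).Nonempty).card

/-- The feasible merges: the pairs of distinct clusters which both have a point of the same target
cluster. -/
def feasibleMerges (target P : Finset (Finset X)) : Finset (Finset (Finset X)) :=
  (P.powersetCard 2).filter fun q => ∃ D ∈ target, ∀ C ∈ q, (C ∩ D).Nonempty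

/-- Feasibility of a request in the unrestricted-merge model. -/
def Feasible (target P : Finset (Finset X)) : Request X → Prop
  | .split C => C ∈ feasibleSplits target P
  | .merge q => q ∈ feasibleMerges target P

/-- The edit of the clustering `P` made on a request. A split replaces the cluster by the two parts
that the split procedure returns. A merge applies the split procedure to the union of the
two clusters: if that gives back the two clusters, they are replaced by their union, otherwise by
the two sets that it returns. -/
def edit (T : LinkageTree X) (P : Finset (Finset X)) : Request X → Finset (Finset X)
  | .split C => (P.erase C) ∪ {(T.split C).1, (T.split C).2}
  | .merge q =>
      if ({(T.split (q.biUnion id)).1, (T.split (q.biUnion id)).2} : Finset (Finset X)) = q then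
        (P \ q) ∪ {q.biUnion id}
      else
        (P \ q) ∪ {(T.split (q.biUnion id)).1, (T.split (q.biUnion id)).2}

/-- The current clustering after a history of requests, when the initial clustering is `P₀`.
Histories list the most recent request first. -/
def current (T : LinkageTree X) (P₀ : Finset (Finset X)) : List (Request X) → Finset (Finset X)
  | [] => P₀
  | r :: h => edit T (current T P₀ h) r

/-- The histories that can occur in the unrestricted-merge model: every request was feasible when it
was made, and was made before the target was reached. -/
def ValidHistory (T : LinkageTree X) (target P₀ : Finset (Finset X)) :
    List (Request X) → Prop
  | [] => True
  | r :: h => ValidHistory T target P₀ h ∧ current T P₀ h ≠ target ∧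
      Feasible target (current T P₀ h) r

/-- An oracle for the unrestricted-merge model with random merges. It chooses the next request by a
probability distribution that may depend on the whole history. As long as the target has not been
reached, all its requests are feasible, and all feasible merges are equally likely, so that
the request is uniformly distributed on the feasible merges given that it is a merge request.
Whether to request a split, and which one, is otherwise arbitrary. -/
def IsRandomMergeOracle (T : LinkageTree X) (target P₀ : Finset (Finset X))
    (oracle : List (Request X) → PMF (Request X)) : Prop :=
  ∀ h : List (Request X), ValidHistory T target P₀ h → current T P₀ h ≠ target →
    (∀ r ∈ (oracle h).support, Feasible target (current T P₀ h) r) ∧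
    (∀ q ∈ feasibleMerges target (current T P₀ h), ∀ q' ∈ feasibleMerges target (current T P₀ h),
      oracle h (.merge q) = oracle h (.merge q'))

/-- The distribution of the history of the interaction after at most `n` requests. The interaction
ends as soon as the current clustering is the target. -/
noncomputable def history (T : LinkageTree X) (target P₀ : Finset (Finset X))
    (oracle : List (Request X) → PMF (Request X)) : ℕ → PMF (List (Request X))
  | 0 => PMF.pure []
  | n + 1 => (history T target P₀ oracle n).bind fun h =>
      if current T P₀ h = target then PMF.pure h else (oracle h).map fun r => r :: h

end Model

/-- The number of split requests in a history. -/
def splitCount {X : Type*} : List (Request X) → ℕ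
  | [] => 0
  | .split _ :: h => splitCount h + 1
  | .merge _ :: h => splitCount h

/-- The number of merge requests in a history. -/
def mergeCount {X : Type*} : List (Request X) → ℕ
  | [] => 0
  | .split _ :: h => mergeCount h
  | .merge _ :: h => mergeCount h + 1

end InteractiveClustering

open InteractiveClustering

/-!
If the target is stable, every node of an average-linkage tree is disjoint from, contained in, or a
superset of each target cluster: a proper part `A` of a target cluster `D` is on average more
similar to `D \ A` than to anything outside `D`, hence also to some current node inside `D`, so it
is never joined to a node outside `D`. Therefore the split of a set divides a target cluster only
if the set lies inside it. It follows that each requested split lowers the overclustering error,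
and that no merge request raises it.

For the merge requests, cut each target cluster into its pieces, the intersections with the current
clusters. A pair of pieces weighs `1` if the two lie below disjoint nodes of the tree, and `2`
otherwise. Splits do not change the total weight. A merge request lowers it, because either two
pieces of one target cluster are united, or two pieces of weight `2` are regrouped by the tree into
two pieces of weight `1`, without raising the weight against the other pieces. The initial weight of
ordered pairs is at most `4 δᵤ²` and each merge request lowers it by at least `2`, so `2 δᵤ²` merge
requests suffice for every sequence of feasible requests. The factor `log (k / ε) ≥ log 2` only
enlarges this bound.
-/

namespace InteractiveClustering

open Finset

/-! ### Nodes of a linkage tree -/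

namespace LinkageTree

variable {X : Type*} [DecidableEq X] {T : LinkageTree X}

/-- The point sets of the nodes of a tree. A tree is identified with this family of sets wherever
only the position of point sets in the tree matters. -/
def nodes : LinkageTree X → Set (Finset X)
  | .leaf x => {{x}}
  | .node l r => insert (l.points ∪ r.points) (l.nodes ∪ r.nodes)

/-- A tree is proper if no point occurs at two different leaves. -/
def Proper : LinkageTree X → Prop
  | .leaf _ => True
  | .node l r => Disjoint l.points r.points ∧ l.Proper ∧ r.Proper

theorem points_nonempty (T : LinkageTree X) : T.points.Nonempty := by
  induction T with
  | leaf x => exact singleton_nonempty x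
  | node l r hl _ => exact hl.mono subset_union_left

theorem points_mem_nodes (T : LinkageTree X) : T.points ∈ T.nodes := by
  cases T with
  | leaf x => exact Set.mem_singleton _
  | node l r => exact Set.mem_insert _ _

theorem nodes_left_subset (l r : LinkageTree X) : l.nodes ⊆ (node l r).nodes :=
  fun _ hN => Or.inr (Or.inl hN)

theorem nodes_right_subset (l r : LinkageTree X) : r.nodes ⊆ (node l r).nodes :=
  fun _ hN => Or.inr (Or.inr hN)

theorem subset_points_of_mem_nodes {N : Finset X} (hN : N ∈ T.nodes) : N ⊆ T.points := by
  induction T with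
  | leaf x => exact (Set.mem_singleton_iff.1 hN).subset
  | node l r hl hr =>
    rcases hN with rfl | hN | hN
    · exact Subset.rfl
    · exact (hl hN).trans subset_union_left
    · exact (hr hN).trans subset_union_right

theorem Proper.laminar (hT : T.Proper) {M N : Finset X} (hM : M ∈ T.nodes) (hN : N ∈ T.nodes) :
    Disjoint M N ∨ M ⊆ N ∨ N ⊆ M := by
  induction T with
  | leaf x =>
    rw [Set.mem_singleton_iff.1 hM, Set.mem_singleton_iff.1 hN]
    exact Or.inr (Or.inl Subset.rfl)
  | node l r hl hr =>
    obtain ⟨hlr, hproper_l, hproper_r⟩ := hT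
    rcases hM with rfl | hMl | hMr
    · exact Or.inr (Or.inr (subset_points_of_mem_nodes hN))
    · rcases hN with rfl | hNl | hNr
      · exact Or.inr (Or.inl (subset_points_of_mem_nodes (nodes_left_subset l r hMl)))
      · exact hl hproper_l hMl hNl
      · exact Or.inl (hlr.mono (subset_points_of_mem_nodes hMl) (subset_points_of_mem_nodes hNr))
    · rcases hN with rfl | hNl | hNr
      · exact Or.inr (Or.inl (subset_points_of_mem_nodes (nodes_right_subset l r hMr)))
      · exact Or.inl
          (hlr.symm.mono (subset_points_of_mem_nodes hMr) (subset_points_of_mem_nodes hNl))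
      · exact hr hproper_r hMr hNr

/-- `L` and `R` are the point sets of two sibling nodes of `T`. The sets stand for the nodes, and
the parent is recorded only through its point set. -/
structure Siblings (T : LinkageTree X) (L R : Finset X) : Prop where
  left_mem : L ∈ T.nodes
  right_mem : R ∈ T.nodes
  union_mem : L ∪ R ∈ T.nodes
  disjoint : Disjoint L R

theorem Siblings.trichotomy {L R N : Finset X} (h : T.Siblings L R) (hT : T.Proper)
    (hN : N ∈ T.nodes) : Disjoint N (L ∪ R) ∨ L ∪ R ⊆ N ∨ N ⊆ L ∨ N ⊆ R := by
  rcases hT.laminar hN h.union_mem with hdisj | hsub | hsup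
  · exact Or.inl hdisj
  · rcases hT.laminar hN h.left_mem with hNL | hNL | hLN
    · exact Or.inr (Or.inr (Or.inr (hNL.left_le_of_le_sup_left hsub)))
    · exact Or.inr (Or.inr (Or.inl hNL))
    · rcases hT.laminar hN h.right_mem with hNR | hNR | hRN
      · exact Or.inr (Or.inr (Or.inl (hNR.left_le_of_le_sup_right hsub)))
      · exact Or.inr (Or.inr (Or.inr hNR))
      · exact Or.inr (Or.inl (union_subset hLN hRN))
  · exact Or.inr (Or.inl hsup)

/-- Two sets of points are separated by a tree if they lie below disjoint nodes of it. -/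
def Separated (T : LinkageTree X) (A B : Finset X) : Prop :=
  ∃ M ∈ T.nodes, ∃ N ∈ T.nodes, A ⊆ M ∧ B ⊆ N ∧ Disjoint M N

theorem Separated.symm {A B : Finset X} (h : T.Separated A B) : T.Separated B A := by
  obtain ⟨M, hM, N, hN, hAM, hBN, hMN⟩ := h
  exact ⟨N, hN, M, hM, hBN, hAM, hMN.symm⟩

theorem Proper.separated_of_subset_union (hT : T.Proper) {A B C E : Finset X}
    (hAB : ¬T.Separated A B) (hAC : T.Separated A C) (hBC : T.Separated B C) (hE : E ⊆ A ∪ B) :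
    T.Separated E C := by
  obtain ⟨M, hM, N, hN, hAM, hCN, hMN⟩ := hAC
  obtain ⟨M', hM', N', hN', hBM', hCN', hMN'⟩ := hBC
  rcases hT.laminar hM hM' with h | h | h
  · exact absurd ⟨M, hM, M', hM', hAM, hBM', h⟩ hAB
  · exact ⟨M', hM', N', hN', hE.trans (union_subset (hAM.trans h) hBM'), hCN', hMN'⟩
  · exact ⟨M, hM, N, hN, hE.trans (union_subset hAM (hBM'.trans h)), hCN, hMN⟩

/-- `E` and `F` are the two parts into which a node of `T` divides `U`: both are non-empty, and they
lie below the left and the right child of that node, respectively. -/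
structure IsSplit (T : LinkageTree X) (U E F : Finset X) : Prop where
  left_nonempty : E.Nonempty
  right_nonempty : F.Nonempty
  union_eq : E ∪ F = U
  exists_siblings : ∃ L R, T.Siblings L R ∧ E ⊆ L ∧ F ⊆ R

theorem IsSplit.mono {T' : LinkageTree X} {U E F : Finset X} (h : T.IsSplit U E F)
    (hTT' : T.nodes ⊆ T'.nodes) : T'.IsSplit U E F := by
  obtain ⟨hE, hF, hU, L, R, hLR, hEL, hFR⟩ := h
  exact ⟨hE, hF, hU, L, R,
    ⟨hTT' hLR.left_mem, hTT' hLR.right_mem, hTT' hLR.union_mem, hLR.disjoint⟩, hEL, hFR⟩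

theorem isSplit_split (hT : T.Proper) {U : Finset X} (hU : U ⊆ T.points) (hU' : U.Nontrivial) :
    T.IsSplit U (T.split U).1 (T.split U).2 := by
  induction T with
  | leaf x =>
    obtain ⟨a, ha, b, hb, hab⟩ := hU'
    exact absurd ((mem_singleton.1 (hU ha)).trans (mem_singleton.1 (hU hb)).symm) hab
  | node l r hl hr =>
    obtain ⟨hlr, hproper_l, hproper_r⟩ := hT
    by_cases hUl : U ⊆ l.points
    · simpa only [split, if_pos hUl] using (hl hproper_l hUl).mono (nodes_left_subset l r)
    by_cases hUr : U ⊆ r.points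
    · simpa only [split, if_neg hUl, if_pos hUr] using
        (hr hproper_r hUr).mono (nodes_right_subset l r)
    obtain ⟨x, hxU, hxr⟩ := not_subset.1 hUr
    obtain ⟨y, hyU, hyl⟩ := not_subset.1 hUl
    have hsiblings : (node l r).Siblings l.points r.points :=
      ⟨nodes_left_subset l r l.points_mem_nodes, nodes_right_subset l r r.points_mem_nodes,
        points_mem_nodes (node l r), hlr⟩
    simp only [split, if_neg hUl, if_neg hUr]
    exact
      { left_nonempty := ⟨x, mem_inter.2 ⟨(mem_union.1 (hU hxU)).resolve_right hxr, hxU⟩⟩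
        right_nonempty := ⟨y, mem_inter.2 ⟨(mem_union.1 (hU hyU)).resolve_left hyl, hyU⟩⟩
        union_eq := by rw [← union_inter_distrib_right]; exact inter_eq_right.2 hU
        exists_siblings :=
          ⟨l.points, r.points, hsiblings, inter_subset_left, inter_subset_left⟩ }

namespace IsSplit

variable {A B C U E F : Finset X}

theorem left_subset (h : T.IsSplit U E F) : E ⊆ U := h.union_eq ▸ subset_union_left

theorem right_subset (h : T.IsSplit U E F) : F ⊆ U := h.union_eq ▸ subset_union_right

theorem separated (h : T.IsSplit U E F) : T.Separated E F := by
  obtain ⟨L, R, hLR, hEL, hFR⟩ := h.exists_siblings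
  exact ⟨L, hLR.left_mem, R, hLR.right_mem, hEL, hFR, hLR.disjoint⟩

theorem disjoint (h : T.IsSplit U E F) : Disjoint E F := by
  obtain ⟨L, R, hLR, hEL, hFR⟩ := h.exists_siblings
  exact hLR.disjoint.mono hEL hFR

theorem subset_or_subset (h : T.IsSplit U E F) (hT : T.Proper) (hA : A.Nonempty) (hB : B.Nonempty)
    (hAU : A ⊆ U) (hBU : B ⊆ U) (hAB : T.Separated A B) : A ⊆ E ∨ A ⊆ F := by
  obtain ⟨L, R, hLR, hEL, hFR⟩ := h.exists_siblings
  obtain ⟨M, hM, N, -, hAM, hBN, hMN⟩ := hAB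
  have hULR : U ⊆ L ∪ R := h.union_eq ▸ union_subset_union hEL hFR
  have hAEF : A ≤ E ⊔ F := hAU.trans h.union_eq.ge
  rcases hLR.trichotomy hT hM with hdisj | hsup | hML | hMR
  · exact absurd (hdisj.mono hAM (hAU.trans hULR)) (by simpa using hA.ne_empty)
  · exact absurd (hMN.mono (hBU.trans (hULR.trans hsup)) hBN) (by simpa using hB.ne_empty)
  · exact Or.inl ((hLR.disjoint.mono (hAM.trans hML) hFR).left_le_of_le_sup_right hAEF)
  · exact Or.inr ((hLR.disjoint.symm.mono (hAM.trans hMR) hEL).left_le_of_le_sup_left hAEF)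

theorem pair_eq_of_separated (h : T.IsSplit (A ∪ B) E F) (hT : T.Proper) (hA : A.Nonempty)
    (hB : B.Nonempty) (hAB : T.Separated A B) : ({E, F} : Finset (Finset X)) = {A, B} := by
  have hEF : E ∪ F = A ∪ B := h.union_eq
  have hsub_A := h.subset_or_subset hT hA hB subset_union_left subset_union_right hAB
  have hsub_B := h.subset_or_subset hT hB hA subset_union_right subset_union_left hAB.symm
  have eq_of_subset {G H G' H' : Finset X} (hG : G ⊆ G') (hH : H ⊆ H') (hdisj : Disjoint G' H')
      (hunion : G' ∪ H' = G ∪ H) : G' = G :=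
    ((hdisj.mono_right hH).left_le_of_le_sup_right (subset_union_left.trans hunion.le)).antisymm hG
  rcases hsub_A with hAE | hAF <;> rcases hsub_B with hBE | hBF
  · have : F ⊆ E := h.right_subset.trans (union_subset hAE hBE)
    exact absurd (h.disjoint.symm.eq_bot_of_le this) h.right_nonempty.ne_empty
  · rw [eq_of_subset hAE hBF h.disjoint hEF,
      eq_of_subset hBF hAE h.disjoint.symm (by rw [union_comm, hEF, union_comm])]
  · rw [eq_of_subset hBE hAF h.disjoint (by rw [hEF, union_comm]),
      eq_of_subset hAF hBE h.disjoint.symm (by rw [union_comm, hEF]), pair_comm]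
  · have : E ⊆ F := h.left_subset.trans (union_subset hAF hBF)
    exact absurd (h.disjoint.eq_bot_of_le this) h.left_nonempty.ne_empty

theorem separated_or_separated (h : T.IsSplit U E F) (hT : T.Proper) (hA : A.Nonempty)
    (hAU : A ⊆ U) (hAC : T.Separated A C) : T.Separated E C ∨ T.Separated F C := by
  obtain ⟨L, R, hLR, hEL, hFR⟩ := h.exists_siblings
  obtain ⟨M, -, N, hN, hAM, hCN, hMN⟩ := hAC
  have hULR : U ⊆ L ∪ R := h.union_eq ▸ union_subset_union hEL hFR
  rcases hLR.trichotomy hT hN with hdisj | hsup | hNL | hNR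
  · exact Or.inl ⟨L ∪ R, hLR.union_mem, N, hN, hEL.trans subset_union_left, hCN, hdisj.symm⟩
  · exact absurd (hMN.mono hAM (hAU.trans (hULR.trans hsup))) (by simpa using hA.ne_empty)
  · exact Or.inr ⟨R, hLR.right_mem, L, hLR.left_mem, hFR, hCN.trans hNL, hLR.disjoint.symm⟩
  · exact Or.inl ⟨L, hLR.left_mem, R, hLR.right_mem, hEL, hCN.trans hNR, hLR.disjoint⟩

end IsSplit

end LinkageTree

/-! ### The potential of a family of pieces -/

section Potential

variable {X : Type*} [DecidableEq X] {T : LinkageTree X} {A B E F : Finset X}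
  {Q : Finset (Finset X)}

open Classical in
/-- The contribution to the potential of two pieces of a target cluster: `1` if the tree separates
them, and `2` otherwise. -/
noncomputable def pairWeight (T : LinkageTree X) (A B : Finset X) : ℕ :=
  if T.Separated A B then 1 else 2

/-- The potential of a family of pieces, the progress measure for merge requests: the total weight
of the ordered pairs of distinct pieces. -/
noncomputable def potential (T : LinkageTree X) (Q : Finset (Finset X)) : ℕ :=
  ∑ p ∈ Q.offDiag, pairWeight T p.1 p.2

theorem pairWeight_of_separated (h : T.Separated A B) : pairWeight T A B = 1 := if_pos h

theorem pairWeight_of_not_separated (h : ¬T.Separated A B) : pairWeight T A B = 2 := if_neg h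

theorem pairWeight_comm (T : LinkageTree X) (A B : Finset X) :
    pairWeight T A B = pairWeight T B A := by
  by_cases h : T.Separated A B
  · rw [pairWeight_of_separated h, pairWeight_of_separated h.symm]
  · rw [pairWeight_of_not_separated h, pairWeight_of_not_separated (mt .symm h)]

theorem one_le_pairWeight (T : LinkageTree X) (A B : Finset X) : 1 ≤ pairWeight T A B := by
  unfold pairWeight
  split_ifs <;> omega

theorem pairWeight_le_two (T : LinkageTree X) (A B : Finset X) : pairWeight T A B ≤ 2 := by
  unfold pairWeight
  split_ifs <;> omega

theorem LinkageTree.IsSplit.pairWeight_add_le (h : T.IsSplit (A ∪ B) E F) (hT : T.Proper)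
    (hA : A.Nonempty) (hB : B.Nonempty) (hAB : ¬T.Separated A B) (C : Finset X) :
    pairWeight T E C + pairWeight T F C ≤ pairWeight T A C + pairWeight T B C := by
  by_cases hAC : T.Separated A C <;> by_cases hBC : T.Separated B C
  · have hEC := hT.separated_of_subset_union hAB hAC hBC h.left_subset
    have hFC := hT.separated_of_subset_union hAB hAC hBC h.right_subset
    simp only [pairWeight_of_separated, *, le_refl]
  · rw [pairWeight_of_separated hAC, pairWeight_of_not_separated hBC]
    rcases h.separated_or_separated hT hA subset_union_left hAC with hEC | hFC
    · linarith [pairWeight_of_separated hEC, pairWeight_le_two T F C]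
    · linarith [pairWeight_of_separated hFC, pairWeight_le_two T E C]
  · rw [pairWeight_of_separated hBC, pairWeight_of_not_separated hAC]
    rcases h.separated_or_separated hT hB subset_union_right hBC with hEC | hFC
    · linarith [pairWeight_of_separated hEC, pairWeight_le_two T F C]
    · linarith [pairWeight_of_separated hFC, pairWeight_le_two T E C]
  · rw [pairWeight_of_not_separated hAC, pairWeight_of_not_separated hBC]
    exact add_le_add (pairWeight_le_two T E C) (pairWeight_le_two T F C)

theorem potential_insert (T : LinkageTree X) (h : A ∉ Q) :
    potential T (insert A Q) = potential T Q + 2 * ∑ C ∈ Q, pairWeight T A C := by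
  have hleft : Disjoint Q.offDiag ({A} ×ˢ Q) := by
    simp only [disjoint_left, mem_offDiag, mem_product, mem_singleton]
    rintro p hp ⟨rfl, -⟩
    exact h hp.1
  have hright : Disjoint (Q.offDiag ∪ {A} ×ˢ Q) (Q ×ˢ {A}) := by
    simp only [disjoint_left, mem_union, mem_offDiag, mem_product, mem_singleton]
    rintro p (hp | hp) ⟨-, rfl⟩
    · exact h hp.2.1
    · exact h hp.2
  rw [potential, offDiag_insert h, sum_union hright, sum_union hleft, sum_product, sum_product,
    sum_singleton]
  simp only [sum_singleton, pairWeight_comm T _ A]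
  rw [potential]
  ring

theorem potential_insert_le (T : LinkageTree X) (A : Finset X) (Q : Finset (Finset X)) :
    potential T (insert A Q) ≤ potential T Q + 2 * ∑ C ∈ Q, pairWeight T A C := by
  by_cases h : A ∈ Q
  · rw [insert_eq_of_mem h]
    exact Nat.le_add_right _ _
  · exact (potential_insert T h).le

theorem potential_insert_insert (T : LinkageTree X) (hA : A ∉ Q) (hB : B ∉ Q) (hAB : A ≠ B) :
    potential T (insert A (insert B Q)) =
      potential T Q + 2 * (∑ C ∈ Q, (pairWeight T A C + pairWeight T B C) + pairWeight T A B) := by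
  rw [potential_insert T (by simp [hA, hAB]), potential_insert T hB, sum_insert hB,
    sum_add_distrib]
  ring

theorem potential_insert_insert_le (T : LinkageTree X) (A B : Finset X) (Q : Finset (Finset X)) :
    potential T (insert A (insert B Q)) ≤
      potential T Q + 2 * (∑ C ∈ Q, (pairWeight T A C + pairWeight T B C) + pairWeight T A B) := by
  have hsum : ∑ C ∈ insert B Q, pairWeight T A C ≤
      pairWeight T A B + ∑ C ∈ Q, pairWeight T A C := by
    by_cases hB : B ∈ Q
    · rw [insert_eq_of_mem hB]
      exact Nat.le_add_left _ _
    · exact (sum_insert hB).le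
  calc potential T (insert A (insert B Q))
      ≤ potential T (insert B Q) + 2 * ∑ C ∈ insert B Q, pairWeight T A C :=
        potential_insert_le T A _
    _ ≤ (potential T Q + 2 * ∑ C ∈ Q, pairWeight T B C) +
          2 * (pairWeight T A B + ∑ C ∈ Q, pairWeight T A C) := by
        gcongr
        exact potential_insert_le T B Q
    _ = _ := by rw [sum_add_distrib]; ring

theorem potential_insert_add_two_le (T : LinkageTree X) (U : Finset X) (hA : A ∉ Q) (hB : B ∉ Q)
    (hAB : A ≠ B) : potential T (insert U Q) + 2 ≤ potential T (insert A (insert B Q)) := by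
  have hsum : ∑ C ∈ Q, pairWeight T U C ≤ ∑ C ∈ Q, (pairWeight T A C + pairWeight T B C) :=
    sum_le_sum fun C _ => (pairWeight_le_two T U C).trans
      (add_le_add (one_le_pairWeight T A C) (one_le_pairWeight T B C))
  have hweight := one_le_pairWeight T A B
  have hunion := potential_insert_le T U Q
  rw [potential_insert_insert T hA hB hAB]
  omega

theorem LinkageTree.IsSplit.potential_add_two_le (h : T.IsSplit (A ∪ B) E F) (hT : T.Proper)
    (hA : A.Nonempty) (hB : B.Nonempty) (hsep : ¬T.Separated A B) (hAQ : A ∉ Q) (hBQ : B ∉ Q)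
    (hAB : A ≠ B) :
    potential T (insert E (insert F Q)) + 2 ≤ potential T (insert A (insert B Q)) := by
  have hsum : ∑ C ∈ Q, (pairWeight T E C + pairWeight T F C) ≤
      ∑ C ∈ Q, (pairWeight T A C + pairWeight T B C) :=
    sum_le_sum fun C _ => h.pairWeight_add_le hT hA hB hsep C
  have hEF := pairWeight_of_separated h.separated
  have hparts := potential_insert_insert_le T E F Q
  rw [potential_insert_insert T hAQ hBQ hAB, pairWeight_of_not_separated hsep]
  omega

theorem potential_le (T : LinkageTree X) (Q : Finset (Finset X)) :
    potential T Q ≤ 4 * (#Q - 1) ^ 2 := by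
  have hpairs : #Q * #Q - #Q ≤ 2 * (#Q - 1) ^ 2 := by
    cases #Q with
    | zero => simp
    | succ n =>
      rw [Nat.add_sub_cancel, Nat.sub_le_iff_le_add]
      nlinarith [Nat.le_self_pow two_ne_zero n]
  calc potential T Q ≤ #Q.offDiag • 2 := sum_le_card_nsmul _ _ _ fun _ _ => pairWeight_le_two T _ _
    _ = (#Q * #Q - #Q) * 2 := by rw [offDiag_card, smul_eq_mul]
    _ ≤ 4 * (#Q - 1) ^ 2 := by omega

end Potential

/-! ### Average linkage and stability -/

section Linkage

variable {X : Type*} {S : X → X → ℝ} {A B : Finset X}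

theorem avgSim_comm (hS : ∀ x y, S x y = S y x) (A B : Finset X) :
    avgSim S A B = avgSim S B A := by
  simp only [avgSim, sum_comm (s := A), mul_comm (#A : ℝ), hS]

theorem avgSim_mul_card (S : X → X → ℝ) (A B : Finset X) :
    avgSim S A B * #B = (∑ y ∈ B, ∑ x ∈ A, S x y) / #A := by
  rcases B.eq_empty_or_nonempty with rfl | hB
  · simp
  · have : (#B : ℝ) ≠ 0 := Nat.cast_ne_zero.2 hB.card_pos.ne'
    rw [avgSim, sum_comm, ← div_div, div_mul_cancel₀ _ this]

/-- A set of points is compatible with a family of clusters if it is disjoint from, contained in, or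
a superset of each of them. -/
def Compatible (P : Finset (Finset X)) (N : Finset X) : Prop :=
  ∀ D ∈ P, Disjoint N D ∨ N ⊆ D ∨ D ⊆ N

theorem compatible_singleton (P : Finset (Finset X)) (x : X) : Compatible P {x} := fun D _ =>
  (em (x ∈ D)).symm.imp disjoint_singleton_left.2 fun h => Or.inl (singleton_subset_iff.2 h)

variable [DecidableEq X]

theorem sum_avgSim_mul_card (S : X → X → ℝ) (A : Finset X) (P : Finpartition B) :
    ∑ C ∈ P.parts, avgSim S A C * #C = avgSim S A B * #B := by
  have hparts : ∑ y ∈ B, ∑ x ∈ A, S x y = ∑ C ∈ P.parts, ∑ y ∈ C, ∑ x ∈ A, S x y := by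
    conv_lhs => rw [← P.biUnion_parts]
    exact sum_biUnion P.supIndep.pairwiseDisjoint
  simp only [avgSim_mul_card, hparts, sum_div]

theorem exists_avgSim_le (S : X → X → ℝ) (A : Finset X) (hB : B.Nonempty) (P : Finpartition B) :
    ∃ C ∈ P.parts, avgSim S A B ≤ avgSim S A C := by
  have hsum : ∑ C ∈ P.parts, avgSim S A B * #C ≤ ∑ C ∈ P.parts, avgSim S A C * #C := by
    rw [sum_avgSim_mul_card, ← mul_sum, ← Nat.cast_sum, P.sum_card_parts]
  obtain ⟨C, hC, hle⟩ := exists_le_of_sum_le (P.parts_nonempty hB.ne_empty) hsum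
  have hpos : (0 : ℝ) < #C := Nat.cast_pos.2 (P.nonempty_of_mem_parts hC).card_pos
  exact ⟨C, hC, le_of_mul_le_mul_right hle hpos⟩

/-- The invariant of bottom-up average linkage for a stable clustering `P`: the current nodes
partition the data set, and all nodes built so far are compatible with `P`. -/
structure CompatibleForest (P : Finset (Finset X)) (F : Set (LinkageTree X)) : Prop where
  proper : ∀ a ∈ F, a.Proper
  disjoint : ∀ a ∈ F, ∀ b ∈ F, a ≠ b → Disjoint a.points b.points
  cover : ∀ x, ∃ a ∈ F, x ∈ a.points
  compatible : ∀ a ∈ F, ∀ N ∈ a.nodes, Compatible P N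

namespace CompatibleForest

variable {P : Finset (Finset X)} {F : Set (LinkageTree X)} {a b : LinkageTree X} {D : Finset X}

theorem points_compatible (hF : CompatibleForest P F) (ha : a ∈ F) : Compatible P a.points :=
  hF.compatible a ha _ a.points_mem_nodes

theorem subset_sdiff_points (hF : CompatibleForest P F) (ha : a ∈ F) (hb : b ∈ F) (hD : D ∈ P)
    (haD : a.points ⊆ D) {x : X} (hxb : x ∈ b.points) (hx : x ∈ D \ a.points) :
    b.points ⊆ D \ a.points := by
  obtain ⟨hxD, hxa⟩ := mem_sdiff.1 hx
  have hba : Disjoint b.points a.points :=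
    hF.disjoint b hb a ha (by rintro rfl; exact hxa hxb)
  rcases hF.points_compatible hb D hD with hdisj | hbD | hDb
  · exact absurd hxD (disjoint_left.1 hdisj hxb)
  · exact subset_sdiff.2 ⟨hbD, hba⟩
  · exact absurd (hba.symm.eq_bot_of_le (haD.trans hDb)) a.points_nonempty.ne_empty

theorem exists_avgSim_sdiff_le (S : X → X → ℝ) (hF : CompatibleForest P F) (ha : a ∈ F)
    (hD : D ∈ P) (haD : a.points ⊂ D) :
    ∃ c ∈ F, c ≠ a ∧ avgSim S a.points (D \ a.points) ≤ avgSim S a.points c.points := by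
  classical
  let parts := (D \ a.points).powerset.filter fun N => ∃ c ∈ F, c.points = N
  have hparts : ∀ x ∈ D \ a.points, ∃! N ∈ parts, x ∈ N := by
    intro x hx
    obtain ⟨c, hc, hxc⟩ := hF.cover x
    have hcD := hF.subset_sdiff_points ha hc hD haD.subset hxc hx
    refine ⟨c.points, ⟨mem_filter.2 ⟨mem_powerset.2 hcD, c, hc, rfl⟩, hxc⟩, ?_⟩
    rintro _ ⟨hN, hxN⟩
    obtain ⟨-, e, he, rfl⟩ := mem_filter.1 hN
    by_contra hne
    exact disjoint_left.1 (hF.disjoint e he c hc fun h => hne (h ▸ rfl)) hxN hxc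
  have hempty : ∅ ∉ parts := fun h => by
    obtain ⟨-, c, -, hc⟩ := mem_filter.1 h
    exact c.points_nonempty.ne_empty hc
  obtain ⟨N, hN, hle⟩ := exists_avgSim_le S a.points (sdiff_nonempty.2 haD.not_subset)
    (.ofExistsUnique parts (fun N hN => mem_powerset.1 (mem_filter.1 hN).1) hparts hempty)
  obtain ⟨hND, c, hc, rfl⟩ := mem_filter.1 hN
  refine ⟨c, hc, ?_, hle⟩
  rintro rfl
  exact c.points_nonempty.ne_empty
    (disjoint_self.1 (disjoint_sdiff.mono_right (mem_powerset.1 hND)))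

theorem range_leaf (P : Finset (Finset X)) : CompatibleForest P (Set.range LinkageTree.leaf) where
  proper := by
    rintro _ ⟨x, rfl⟩
    trivial
  disjoint := by
    rintro _ ⟨x, rfl⟩ _ ⟨y, rfl⟩ hxy
    exact disjoint_singleton.2 fun h => hxy (h ▸ rfl)
  cover x := ⟨_, ⟨x, rfl⟩, mem_singleton_self x⟩
  compatible := by
    rintro _ ⟨x, rfl⟩ N hN
    rw [Set.mem_singleton_iff.1 hN]
    exact compatible_singleton P x

theorem join (hF : CompatibleForest P F) (ha : a ∈ F) (hb : b ∈ F) (hab : a ≠ b)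
    (hunion : Compatible P (a.points ∪ b.points)) :
    CompatibleForest P (insert (.node a b) (F \ {a, b})) := by
  have hdisj : ∀ c ∈ F \ {a, b}, Disjoint (LinkageTree.node a b).points c.points := by
    rintro c ⟨hc, hcab⟩
    simp only [Set.mem_insert_iff, Set.mem_singleton_iff, not_or] at hcab
    exact disjoint_union_left.2
      ⟨hF.disjoint a ha c hc (Ne.symm hcab.1), hF.disjoint b hb c hc (Ne.symm hcab.2)⟩
  refine ⟨?proper, ?disjoint, ?cover, ?compatible⟩
  case proper =>
    rintro c (rfl | hc)
    · exact ⟨hF.disjoint a ha b hb hab, hF.proper a ha, hF.proper b hb⟩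
    · exact hF.proper c hc.1
  case disjoint =>
    rintro c (rfl | hc) e (rfl | he) hce
    · exact absurd rfl hce
    · exact hdisj e he
    · exact (hdisj c hc).symm
    · exact hF.disjoint c hc.1 e he.1 hce
  case cover =>
    intro x
    obtain ⟨c, hc, hxc⟩ := hF.cover x
    by_cases hcab : c ∈ ({a, b} : Set (LinkageTree X))
    · refine ⟨_, Set.mem_insert _ _, ?_⟩
      rcases hcab with rfl | rfl
      · exact mem_union_left _ hxc
      · exact mem_union_right _ hxc
    · exact ⟨c, Or.inr ⟨hc, hcab⟩, hxc⟩
  case compatible =>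
    rintro c (rfl | hc) N hN
    · rcases hN with rfl | hN | hN
      · exact hunion
      · exact hF.compatible a ha N hN
      · exact hF.compatible b hb N hN
    · exact hF.compatible c hc.1 N hN

end CompatibleForest

variable [Fintype X] {P : Finpartition (univ : Finset X)} {F : Set (LinkageTree X)}
  {a b : LinkageTree X} {D : Finset X}

theorem Stable.avgSim_lt (hS : Stable S P.parts) (hD : D ∈ P.parts) (hA : A.Nonempty)
    (hAD : A ⊂ D) (hB : B.Nonempty) (hBD : Disjoint B D) :
    avgSim S A B < avgSim S A (D \ A) := by
  obtain ⟨C, hC, hle⟩ := exists_avgSim_le S A hB (P.restrict (subset_univ B))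
  have hC_nonempty : C.Nonempty := Finpartition.nonempty_of_mem_parts _ hC
  obtain ⟨D', hD', rfl⟩ := mem_image.1 (mem_of_mem_erase hC)
  refine hle.trans_lt (hS D hD D' hD' ?_ A _ hA hAD hC_nonempty inter_subset_left)
  rintro rfl
  exact hC_nonempty.ne_empty (disjoint_iff_inter_eq_empty.1 hBD.symm)

theorem CompatibleForest.not_disjoint_of_avgSim_maximal (hF : CompatibleForest P.parts F)
    (hS : Stable S P.parts) (ha : a ∈ F) (hD : D ∈ P.parts) (haD : a.points ⊂ D)
    (hmax : ∀ c ∈ F, c ≠ a → avgSim S a.points c.points ≤ avgSim S a.points b.points) :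
    ¬Disjoint b.points D := fun hbD => by
  obtain ⟨c, hc, hca, hle⟩ := hF.exists_avgSim_sdiff_le S ha hD haD
  exact (((hmax c hc hca).trans_lt
    (hS.avgSim_lt hD a.points_nonempty haD b.points_nonempty hbD)).trans_le hle).false

theorem CompatibleForest.points_union_compatible (hF : CompatibleForest P.parts F)
    (hS : Stable S P.parts) (hsymm : ∀ x y, S x y = S y x) (ha : a ∈ F) (hb : b ∈ F)
    (hmax : ∀ c ∈ F, ∀ d ∈ F, c ≠ d → avgSim S c.points d.points ≤ avgSim S a.points b.points) :
    Compatible P.parts (a.points ∪ b.points) := by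
  intro D hD
  by_cases hDa : D ⊆ a.points
  · exact Or.inr (Or.inr (hDa.trans subset_union_left))
  by_cases hDb : D ⊆ b.points
  · exact Or.inr (Or.inr (hDb.trans subset_union_right))
  rcases hF.points_compatible ha D hD with haD | haD | hDa'
  · rcases hF.points_compatible hb D hD with hbD | hbD | hDb'
    · exact Or.inl (disjoint_union_left.2 ⟨haD, hbD⟩)
    · refine absurd haD (hF.not_disjoint_of_avgSim_maximal hS hb hD ⟨hbD, hDb⟩ fun c hc hcb => ?_)
      rw [avgSim_comm hsymm b.points a.points]
      exact hmax b hb c hc hcb.symm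
    · exact absurd hDb' hDb
  · rcases hF.points_compatible hb D hD with hbD | hbD | hDb'
    · exact absurd hbD (hF.not_disjoint_of_avgSim_maximal hS ha hD ⟨haD, hDa⟩ fun c hc hca =>
        hmax a ha c hc hca.symm)
    · exact Or.inr (Or.inl (union_subset haD hbD))
    · exact absurd hDb' hDb
  · exact absurd hDa' hDa

/-- The trees on which the split procedure respects the clusters in `P`: proper trees of the whole
data set all of whose nodes are compatible with `P`. -/
structure LinkageTree.IsCompatible (T : LinkageTree X) (P : Finset (Finset X)) : Prop where
  proper : T.Proper
  points_eq_univ : T.points = univ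
  compatible : ∀ N ∈ T.nodes, Compatible P N

theorem IsAverageLinkageTree.isCompatible {T : LinkageTree X} (hT : IsAverageLinkageTree S T)
    (hsymm : ∀ x y, S x y = S y x) (hS : Stable S P.parts) : T.IsCompatible P.parts := by
  have hforest {F : Set (LinkageTree X)}
      (hF : Relation.ReflTransGen (LinkageStep S) (Set.range LinkageTree.leaf) F) :
      CompatibleForest P.parts F := by
    induction hF with
    | refl => exact .range_leaf P.parts
    | tail _ hstep ih =>
      obtain ⟨a, ha, b, hb, hab, hmax, rfl⟩ := hstep
      exact ih.join ha hb hab (ih.points_union_compatible hS hsymm ha hb hmax)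
  refine ⟨(hforest hT).proper T rfl, eq_univ_of_forall fun x => ?_, (hforest hT).compatible T rfl⟩
  obtain ⟨_, rfl, hx⟩ := (hforest hT).cover x
  exact hx

end Linkage

/-! ### Pieces of target clusters and distances to the target -/

section Distances

variable {X : Type*} [DecidableEq X] {T : LinkageTree X} {A B D : Finset X}
  {P Q : Finset (Finset X)}

/-- The clusters of `P` that contain points of `A`. Their number exceeds `clusterDist A P` by one
unless there are none. -/
def clustersMeeting (P : Finset (Finset X)) (A : Finset X) : Finset (Finset X) :=
  P.filter fun B => (B ∩ A).Nonempty

/-- The pieces into which a clustering `P` cuts the set `D`: the non-empty intersections of `D` with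
clusters of `P`. -/
def pieces (D : Finset X) (P : Finset (Finset X)) : Finset (Finset X) :=
  (clustersMeeting P D).image (· ∩ D)

theorem clusterDist_eq (A : Finset X) (P : Finset (Finset X)) :
    clusterDist A P = #(clustersMeeting P A) - 1 := rfl

theorem clustersMeeting_union (P : Finset (Finset X)) (A B : Finset X) :
    clustersMeeting P (A ∪ B) = clustersMeeting P A ∪ clustersMeeting P B := by
  simp only [clustersMeeting, inter_union_distrib_left, union_nonempty, filter_or]

theorem clusterDist_union_le (hD : D ∈ P) (hAD : (A ∩ D).Nonempty) (hBD : (B ∩ D).Nonempty) :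
    clusterDist (A ∪ B) P ≤ clusterDist A P + clusterDist B P := by
  have hcommon : 0 < #(clustersMeeting P A ∩ clustersMeeting P B) :=
    card_pos.2 ⟨D, mem_inter.2 ⟨mem_filter.2 ⟨hD, by rwa [inter_comm]⟩,
      mem_filter.2 ⟨hD, by rwa [inter_comm]⟩⟩⟩
  have hcard := card_union_add_card_inter (clustersMeeting P A) (clustersMeeting P B)
  rw [clusterDist_eq, clustersMeeting_union, clusterDist_eq, clusterDist_eq]
  omega

theorem pieces_insert_of_nonempty (Q : Finset (Finset X)) (h : (A ∩ D).Nonempty) :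
    pieces D (insert A Q) = insert (A ∩ D) (pieces D Q) := by
  rw [pieces, clustersMeeting, filter_insert, if_pos h, image_insert, ← clustersMeeting, ← pieces]

theorem pieces_insert_of_disjoint (Q : Finset (Finset X)) (h : Disjoint A D) :
    pieces D (insert A Q) = pieces D Q := by
  rw [pieces, clustersMeeting, filter_insert,
    if_neg (mt not_disjoint_iff_nonempty_inter.2 (not_not.2 h)), ← clustersMeeting, ← pieces]

theorem pieces_insert_congr (Q : Finset (Finset X)) (h : A ∩ D = B ∩ D) :
    pieces D (insert A Q) = pieces D (insert B Q) := by
  rcases disjoint_or_nonempty_inter A D with hAD | hAD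
  · have hBD : Disjoint B D :=
      disjoint_iff_inter_eq_empty.2 (h.symm.trans (disjoint_iff_inter_eq_empty.1 hAD))
    rw [pieces_insert_of_disjoint Q hAD, pieces_insert_of_disjoint Q hBD]
  · rw [pieces_insert_of_nonempty Q hAD, pieces_insert_of_nonempty Q (h ▸ hAD), h]

theorem pieces_insert_insert (Q : Finset (Finset X)) (h : Disjoint A D ∨ Disjoint B D) :
    pieces D (insert A (insert B Q)) = pieces D (insert (A ∪ B) Q) := by
  rcases h with hA | hB
  · rw [pieces_insert_of_disjoint _ hA]
    refine pieces_insert_congr Q ?_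
    rw [union_inter_distrib_right, disjoint_iff_inter_eq_empty.1 hA, empty_union]
  · rw [insert_comm, pieces_insert_of_disjoint _ hB]
    refine pieces_insert_congr Q ?_
    rw [union_inter_distrib_right, disjoint_iff_inter_eq_empty.1 hB, union_empty]

theorem inter_notMem_pieces (hA : (A ∩ D).Nonempty) (hQ : ∀ C ∈ Q, Disjoint A C) :
    A ∩ D ∉ pieces D Q := fun h => by
  obtain ⟨C, hC, hCA⟩ := mem_image.1 h
  have hdisj : Disjoint (A ∩ D) (C ∩ D) :=
    (hQ C (mem_filter.1 hC).1).mono inter_subset_left inter_subset_left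
  exact hA.ne_empty (disjoint_self.1 (hCA ▸ hdisj))

theorem potential_pieces_le (T : LinkageTree X) (D : Finset X) (P : Finset (Finset X)) :
    potential T (pieces D P) ≤ 4 * clusterDist D P ^ 2 := by
  rw [clusterDist_eq]
  exact (potential_le T _).trans <| Nat.mul_le_mul_left 4 <|
    Nat.pow_le_pow_left (Nat.sub_le_sub_right card_image_le 1) 2

/-- The total potential of the target clusters, each cut into its pieces by the clustering `P`. -/
noncomputable def totalPotential (T : LinkageTree X) (target P : Finset (Finset X)) : ℕ :=
  ∑ D ∈ target, potential T (pieces D P)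

theorem totalPotential_le (T : LinkageTree X) (target P : Finset (Finset X)) :
    totalPotential T target P ≤ 4 * underclusteringError P target ^ 2 :=
  calc totalPotential T target P
      ≤ ∑ D ∈ target, 4 * clusterDist D P ^ 2 := sum_le_sum fun D _ => potential_pieces_le T D P
    _ = 4 * ∑ D ∈ target, clusterDist D P ^ 2 := (mul_sum _ _ _).symm
    _ ≤ 4 * underclusteringError P target ^ 2 :=
        Nat.mul_le_mul_left 4 (sum_sq_le_sq_sum_of_nonneg fun _ _ => Nat.zero_le _)

theorem totalPotential_add_two_le {target P P' : Finset (Finset X)} (hD : D ∈ target)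
    (hle : ∀ C ∈ target, potential T (pieces C P') ≤ potential T (pieces C P))
    (hlt : potential T (pieces D P') + 2 ≤ potential T (pieces D P)) :
    totalPotential T target P' + 2 ≤ totalPotential T target P := by
  have hrest : ∑ C ∈ target.erase D, potential T (pieces C P') ≤
      ∑ C ∈ target.erase D, potential T (pieces C P) :=
    sum_le_sum fun C hC => hle C (mem_of_mem_erase hC)
  rw [totalPotential, totalPotential, ← add_sum_erase target _ hD, ← add_sum_erase target _ hD]
  omega

theorem overclusteringError_insert (target : Finset (Finset X)) (h : A ∉ Q) :
    overclusteringError (insert A Q) target = clusterDist A target + overclusteringError Q target :=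
  sum_insert h

theorem overclusteringError_insert_le (A : Finset X) (Q target : Finset (Finset X)) :
    overclusteringError (insert A Q) target ≤
      clusterDist A target + overclusteringError Q target := by
  by_cases h : A ∈ Q
  · rw [insert_eq_of_mem h]
    exact Nat.le_add_left _ _
  · exact (overclusteringError_insert target h).le

theorem overclusteringError_insert_insert_le (A B : Finset X) (Q target : Finset (Finset X)) :
    overclusteringError (insert A (insert B Q)) target ≤
      clusterDist A target + clusterDist B target + overclusteringError Q target := by
  have hA := overclusteringError_insert_le A (insert B Q) target
  have hB := overclusteringError_insert_le B Q target
  omega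

end Distances

/-! ### Splits by a compatible tree -/

section Splits

variable {X : Type*} [DecidableEq X] [Fintype X] {T : LinkageTree X} {D E F U : Finset X}

namespace LinkageTree.IsSplit

theorem subset_or_disjoint_or_disjoint {P : Finset (Finset X)} (h : T.IsSplit U E F)
    (hT : T.IsCompatible P) (hD : D ∈ P) : U ⊆ D ∨ Disjoint E D ∨ Disjoint F D := by
  obtain ⟨L, R, hLR, hEL, hFR⟩ := h.exists_siblings
  rcases hT.compatible L hLR.left_mem D hD with hLD | hLD | hDL
  · exact Or.inr (Or.inl (hLD.mono_left hEL))
  · rcases hT.compatible R hLR.right_mem D hD with hRD | hRD | hDR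
    · exact Or.inr (Or.inr (hRD.mono_left hFR))
    · exact Or.inl (h.union_eq ▸ union_subset (hEL.trans hLD) (hFR.trans hRD))
    · exact Or.inr (Or.inl (hLR.disjoint.mono hEL hDR))
  · exact Or.inr (Or.inr (hLR.disjoint.symm.mono hFR hDL))

theorem pieces_insert_insert {P : Finset (Finset X)} (h : T.IsSplit U E F) (hT : T.IsCompatible P)
    (hD : D ∈ P) (hUD : ¬U ⊆ D) (Q : Finset (Finset X)) :
    pieces D (insert E (insert F Q)) = pieces D (insert U Q) := by
  rw [InteractiveClustering.pieces_insert_insert Q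
    ((h.subset_or_disjoint_or_disjoint hT hD).resolve_left hUD), h.union_eq]

theorem totalPotential_insert_insert {P : Finset (Finset X)} (h : T.IsSplit U E F)
    (hT : T.IsCompatible P) (hU : ∀ D ∈ P, ¬U ⊆ D) (Q : Finset (Finset X)) :
    totalPotential T P (insert E (insert F Q)) = totalPotential T P (insert U Q) :=
  sum_congr rfl fun D hD => by rw [h.pieces_insert_insert hT hD (hU D hD)]

variable {target : Finpartition (univ : Finset X)}

theorem clusterDist_add_add_one_le (h : T.IsSplit U E F) (hT : T.IsCompatible target.parts)
    (hU : ∀ D ∈ target.parts, ¬U ⊆ D) :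
    clusterDist E target.parts + clusterDist F target.parts + 1 ≤ clusterDist U target.parts := by
  have hpos {A : Finset X} (hA : A.Nonempty) : 0 < #(clustersMeeting target.parts A) := by
    obtain ⟨x, hx⟩ := hA
    obtain ⟨D, hD, hxD⟩ := target.exists_mem (mem_univ x)
    exact card_pos.2 ⟨D, mem_filter.2 ⟨hD, x, mem_inter.2 ⟨hxD, hx⟩⟩⟩
  have hdisj : Disjoint (clustersMeeting target.parts E) (clustersMeeting target.parts F) := by
    refine disjoint_left.2 fun D hDE hDF => ?_
    obtain ⟨hD, hDE⟩ := mem_filter.1 hDE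
    obtain ⟨-, hDF⟩ := mem_filter.1 hDF
    rcases (h.subset_or_disjoint_or_disjoint hT hD).resolve_left (hU D hD) with hED | hFD
    · exact not_disjoint_iff_nonempty_inter.2 hDE hED.symm
    · exact not_disjoint_iff_nonempty_inter.2 hDF hFD.symm
  have hE := hpos h.left_nonempty
  have hF := hpos h.right_nonempty
  rw [← h.union_eq, clusterDist_eq, clusterDist_eq, clusterDist_eq, clustersMeeting_union,
    card_union_of_disjoint hdisj]
  omega

end LinkageTree.IsSplit

variable {target : Finpartition (univ : Finset X)}

theorem card_clustersMeeting_le_one (hD : D ∈ target.parts) (hUD : U ⊆ D) :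
    #(clustersMeeting target.parts U) ≤ 1 := by
  refine card_le_one_iff_subset_singleton.2 ⟨D, fun C hC => mem_singleton.2 ?_⟩
  obtain ⟨hC, hCU⟩ := mem_filter.1 hC
  by_contra hCD
  exact not_disjoint_iff_nonempty_inter.2 hCU ((target.disjoint hC hD hCD).mono_right hUD)

theorem clusterDist_eq_zero (hD : D ∈ target.parts) (hUD : U ⊆ D) :
    clusterDist U target.parts = 0 :=
  Nat.sub_eq_zero_of_le (card_clustersMeeting_le_one hD hUD)

theorem LinkageTree.IsSplit.clusterDist_add_le (h : T.IsSplit U E F)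
    (hT : T.IsCompatible target.parts) :
    clusterDist E target.parts + clusterDist F target.parts ≤ clusterDist U target.parts := by
  by_cases hU : ∃ D ∈ target.parts, U ⊆ D
  · obtain ⟨D, hD, hUD⟩ := hU
    rw [clusterDist_eq_zero hD (h.left_subset.trans hUD),
      clusterDist_eq_zero hD (h.right_subset.trans hUD)]
    exact Nat.zero_le _
  · push Not at hU
    exact (Nat.le_succ _).trans (h.clusterDist_add_add_one_le hT hU)

end Splits

/-! ### The effect of an edit -/

section Edits

variable {X : Type*} [DecidableEq X] {T : LinkageTree X} {A B C D E F : Finset X}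
  {P Q target : Finset (Finset X)}

theorem pieces_insert_of_subset (Q : Finset (Finset X)) (hA : A.Nonempty) (hAD : A ⊆ D) :
    pieces D (insert A Q) = insert A (pieces D Q) := by
  have hinter : A ∩ D = A := inter_eq_left.2 hAD
  rw [pieces_insert_of_nonempty Q (hinter.symm ▸ hA), hinter]

theorem pairwiseDisjoint_insert_insert (hQ : (Q : Set (Finset X)).PairwiseDisjoint id)
    (hEF : Disjoint E F) (hrest : ∀ C ∈ Q, Disjoint (E ∪ F) C) :
    ((insert E (insert F Q) : Finset (Finset X)) : Set (Finset X)).PairwiseDisjoint id := by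
  rw [coe_insert, coe_insert]
  refine (hQ.insert fun C hC _ => (hrest C hC).mono_left subset_union_right).insert ?_
  rintro C (rfl | hC) _
  · exact hEF
  · exact (hrest C hC).mono_left subset_union_left

/-- The pair of clusters `A`, `B` is a feasible merge in a clustering whose other clusters form the
family `Q`. -/
structure IsMergeable (target Q : Finset (Finset X)) (A B : Finset X) : Prop where
  disjoint : Disjoint A B
  disjoint_rest : ∀ C ∈ Q, Disjoint (A ∪ B) C
  exists_common : ∃ D ∈ target, (A ∩ D).Nonempty ∧ (B ∩ D).Nonempty

theorem exists_isMergeable (hP : (P : Set (Finset X)).PairwiseDisjoint id)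
    {q : Finset (Finset X)} (hq : q ∈ feasibleMerges target P) :
    ∃ A B Q, q = {A, B} ∧ P = insert A (insert B Q) ∧ IsMergeable target Q A B := by
  obtain ⟨hqP, D, hD, hqD⟩ := mem_filter.1 hq
  obtain ⟨hqP, hcard⟩ := mem_powersetCard.1 hqP
  obtain ⟨A, B, hAB, rfl⟩ := card_eq_two.1 hcard
  have hA : A ∈ P := hqP (by simp)
  have hB : B ∈ P := hqP (by simp)
  refine ⟨A, B, P \ {A, B}, rfl, ?_, hP hA hB hAB, fun C hC => ?_, D, hD, hqD A (by simp),
    hqD B (by simp)⟩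
  · exact (union_sdiff_of_subset hqP).symm.trans (by rw [insert_union, singleton_union])
  · simp only [mem_sdiff, mem_insert, mem_singleton, not_or] at hC
    exact disjoint_union_left.2 ⟨hP hA hC.1 (Ne.symm hC.2.1), hP hB hC.1 (Ne.symm hC.2.2)⟩

namespace IsMergeable

theorem left_nonempty (h : IsMergeable target Q A B) : A.Nonempty := by
  obtain ⟨D, -, hAD, -⟩ := h.exists_common
  exact hAD.mono inter_subset_left

theorem right_nonempty (h : IsMergeable target Q A B) : B.Nonempty := by
  obtain ⟨D, -, -, hBD⟩ := h.exists_common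
  exact hBD.mono inter_subset_left

theorem left_disjoint_rest (h : IsMergeable target Q A B) : ∀ C ∈ Q, Disjoint A C :=
  fun C hC => (h.disjoint_rest C hC).mono_left subset_union_left

theorem right_disjoint_rest (h : IsMergeable target Q A B) : ∀ C ∈ Q, Disjoint B C :=
  fun C hC => (h.disjoint_rest C hC).mono_left subset_union_right

theorem ne (h : IsMergeable target Q A B) : A ≠ B :=
  h.disjoint.ne h.left_nonempty.ne_empty

theorem left_notMem (h : IsMergeable target Q A B) : A ∉ Q := fun hA =>
  h.left_nonempty.ne_empty (disjoint_self.1 (h.left_disjoint_rest A hA))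

theorem right_notMem (h : IsMergeable target Q A B) : B ∉ Q := fun hB =>
  h.right_nonempty.ne_empty (disjoint_self.1 (h.right_disjoint_rest B hB))

theorem union_nontrivial (h : IsMergeable target Q A B) : (A ∪ B).Nontrivial := by
  obtain ⟨x, hx⟩ := h.left_nonempty
  obtain ⟨y, hy⟩ := h.right_nonempty
  exact ⟨x, mem_union_left B hx, y, mem_union_right A hy, disjoint_iff_ne.1 h.disjoint x hx y hy⟩

theorem potential_pieces_union_add_two_le (h : IsMergeable target Q A B) (T : LinkageTree X)
    (hAD : (A ∩ D).Nonempty) (hBD : (B ∩ D).Nonempty) :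
    potential T (pieces D (insert (A ∪ B) Q)) + 2 ≤
      potential T (pieces D (insert A (insert B Q))) := by
  have hUD : ((A ∪ B) ∩ D).Nonempty := hAD.mono (inter_subset_inter_right subset_union_left)
  rw [pieces_insert_of_nonempty _ hUD, pieces_insert_of_nonempty _ hAD,
    pieces_insert_of_nonempty _ hBD]
  exact potential_insert_add_two_le T _ (inter_notMem_pieces hAD h.left_disjoint_rest)
    (inter_notMem_pieces hBD h.right_disjoint_rest)
    ((h.disjoint.mono inter_subset_left inter_subset_left).ne hAD.ne_empty)

theorem potential_pieces_insert_insert_add_two_le (h : IsMergeable target Q A B) (hT : T.Proper)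
    (hs : T.IsSplit (A ∪ B) E F) (hsep : ¬T.Separated A B) (hD : A ∪ B ⊆ D) :
    potential T (pieces D (insert E (insert F Q))) + 2 ≤
      potential T (pieces D (insert A (insert B Q))) := by
  have hAD : A ⊆ D := subset_union_left.trans hD
  have hBD : B ⊆ D := subset_union_right.trans hD
  have notMem {G : Finset X} (hG : G.Nonempty) (hGD : G ⊆ D) (hrest : ∀ C ∈ Q, Disjoint G C) :
      G ∉ pieces D Q := by
    have hinter : G ∩ D = G := inter_eq_left.2 hGD
    have hpiece : G ∩ D ∉ pieces D Q := inter_notMem_pieces (hinter.symm ▸ hG) hrest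
    rwa [hinter] at hpiece
  rw [pieces_insert_of_subset _ hs.left_nonempty (hs.left_subset.trans hD),
    pieces_insert_of_subset _ hs.right_nonempty (hs.right_subset.trans hD),
    pieces_insert_of_subset _ h.left_nonempty hAD, pieces_insert_of_subset _ h.right_nonempty hBD]
  exact hs.potential_add_two_le hT h.left_nonempty h.right_nonempty hsep
    (notMem h.left_nonempty hAD h.left_disjoint_rest)
    (notMem h.right_nonempty hBD h.right_disjoint_rest) h.ne

end IsMergeable

variable [Fintype X]

theorem LinkageTree.IsCompatible.isSplit_split (hT : T.IsCompatible target) (hC : C.Nontrivial) :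
    T.IsSplit C (T.split C).1 (T.split C).2 :=
  LinkageTree.isSplit_split hT.proper (hT.points_eq_univ ▸ subset_univ C) hC

namespace IsMergeable

theorem edit_cases (h : IsMergeable target Q A B) (hT : T.IsCompatible target) :
    edit T (insert A (insert B Q)) (.merge {A, B}) = insert (A ∪ B) Q ∨
      ∃ E F, T.IsSplit (A ∪ B) E F ∧ ¬T.Separated A B ∧
        edit T (insert A (insert B Q)) (.merge {A, B}) = insert E (insert F Q) := by
  have hunion : ({A, B} : Finset (Finset X)).biUnion id = A ∪ B := by simp
  have hrest : insert A (insert B Q) \ {A, B} = Q := by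
    rw [insert_sdiff_of_mem _ (by simp), insert_sdiff_of_mem _ (by simp), sdiff_eq_self_of_disjoint]
    simp [h.left_notMem, h.right_notMem]
  have hsplit := hT.isSplit_split h.union_nontrivial
  rw [edit, hunion, hrest]
  split_ifs with hpair
  · left
    rw [union_comm, singleton_union]
  · refine Or.inr ⟨_, _, hsplit, fun hsep => hpair ?_, ?_⟩
    · exact hsplit.pair_eq_of_separated hT.proper h.left_nonempty h.right_nonempty hsep
    · rw [union_comm, insert_union, singleton_union]

theorem pairwiseDisjoint_edit (h : IsMergeable target Q A B) (hT : T.IsCompatible target)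
    (hQ : (Q : Set (Finset X)).PairwiseDisjoint id) :
    (edit T (insert A (insert B Q)) (.merge {A, B}) : Set (Finset X)).PairwiseDisjoint id := by
  rcases h.edit_cases hT with hedit | ⟨E, F, hs, -, hedit⟩ <;> rw [hedit]
  · rw [coe_insert]
    exact hQ.insert fun C hC _ => h.disjoint_rest C hC
  · exact pairwiseDisjoint_insert_insert hQ hs.disjoint (hs.union_eq.symm ▸ h.disjoint_rest)

theorem potential_pieces_edit_add_two_le (h : IsMergeable target Q A B)
    (hT : T.IsCompatible target) (hD : D ∈ target) (hAD : (A ∩ D).Nonempty)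
    (hBD : (B ∩ D).Nonempty) :
    potential T (pieces D (edit T (insert A (insert B Q)) (.merge {A, B}))) + 2 ≤
      potential T (pieces D (insert A (insert B Q))) := by
  rcases h.edit_cases hT with hedit | ⟨E, F, hs, hsep, hedit⟩ <;> rw [hedit]
  · exact h.potential_pieces_union_add_two_le T hAD hBD
  · by_cases hUD : A ∪ B ⊆ D
    · exact h.potential_pieces_insert_insert_add_two_le hT.proper hs hsep hUD
    · rw [hs.pieces_insert_insert hT hD hUD]
      exact h.potential_pieces_union_add_two_le T hAD hBD

theorem potential_pieces_edit_le (h : IsMergeable target Q A B) (hT : T.IsCompatible target)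
    (hD : D ∈ target) :
    potential T (pieces D (edit T (insert A (insert B Q)) (.merge {A, B}))) ≤
      potential T (pieces D (insert A (insert B Q))) := by
  by_cases hmeet : (A ∩ D).Nonempty ∧ (B ∩ D).Nonempty
  · exact (Nat.le_add_right _ 2).trans (h.potential_pieces_edit_add_two_le hT hD hmeet.1 hmeet.2)
  have hdisj : Disjoint A D ∨ Disjoint B D := by
    simpa only [not_and_or, ← not_disjoint_iff_nonempty_inter, not_not] using hmeet
  have hUD : ¬A ∪ B ⊆ D := fun hUD => hmeet
    ⟨(inter_eq_left.2 (subset_union_left.trans hUD)).symm ▸ h.left_nonempty,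
      (inter_eq_left.2 (subset_union_right.trans hUD)).symm ▸ h.right_nonempty⟩
  rw [pieces_insert_insert Q hdisj]
  rcases h.edit_cases hT with hedit | ⟨E, F, hs, -, hedit⟩ <;> rw [hedit]
  rw [hs.pieces_insert_insert hT hD hUD]

theorem totalPotential_edit_add_two_le (h : IsMergeable target Q A B)
    (hT : T.IsCompatible target) :
    totalPotential T target (edit T (insert A (insert B Q)) (.merge {A, B})) + 2 ≤
      totalPotential T target (insert A (insert B Q)) := by
  obtain ⟨D, hD, hAD, hBD⟩ := h.exists_common
  exact totalPotential_add_two_le hD (fun C hC => h.potential_pieces_edit_le hT hC)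
    (h.potential_pieces_edit_add_two_le hT hD hAD hBD)

theorem overclusteringError_edit_le {target : Finpartition (univ : Finset X)}
    (h : IsMergeable target.parts Q A B) (hT : T.IsCompatible target.parts) :
    overclusteringError (edit T (insert A (insert B Q)) (.merge {A, B})) target.parts ≤
      overclusteringError (insert A (insert B Q)) target.parts := by
  obtain ⟨D, hD, hAD, hBD⟩ := h.exists_common
  have hunion := clusterDist_union_le hD hAD hBD
  rw [overclusteringError_insert _ (by simp [h.ne, h.left_notMem]),
    overclusteringError_insert _ h.right_notMem]
  rcases h.edit_cases hT with hedit | ⟨E, F, hs, -, hedit⟩ <;> rw [hedit]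
  · have hinsert := overclusteringError_insert_le (A ∪ B) Q target.parts
    omega
  · have hparts := hs.clusterDist_add_le hT
    have hinsert := overclusteringError_insert_insert_le E F Q target.parts
    omega

end IsMergeable

section SplitRequests

variable {target : Finpartition (univ : Finset X)}

theorem not_subset_of_mem_feasibleSplits (hC : C ∈ feasibleSplits target.parts P) :
    ∀ D ∈ target.parts, ¬C ⊆ D := fun _ hD hCD =>
  (card_clustersMeeting_le_one hD hCD).not_gt (mem_filter.1 hC).2

theorem nontrivial_of_mem_feasibleSplits (hC : C ∈ feasibleSplits target.parts P) :
    C.Nontrivial := by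
  obtain ⟨D, hDC, D', hDC', hne⟩ := one_lt_card.1 (mem_filter.1 hC).2
  obtain ⟨hD, x, hx⟩ := mem_filter.1 hDC
  obtain ⟨hD', y, hy⟩ := mem_filter.1 hDC'
  obtain ⟨hxD, hxC⟩ := mem_inter.1 hx
  obtain ⟨hyD, hyC⟩ := mem_inter.1 hy
  exact ⟨x, hxC, y, hyC, disjoint_iff_ne.1 (target.disjoint hD hD' hne) x hxD y hyD⟩

theorem exists_isSplit_edit_split (hT : T.IsCompatible target.parts)
    (hC : C ∈ feasibleSplits target.parts P) :
    ∃ E F, T.IsSplit C E F ∧ edit T P (.split C) = insert E (insert F (P.erase C)) :=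
  ⟨_, _, hT.isSplit_split (nontrivial_of_mem_feasibleSplits hC), by
    rw [edit, union_comm, insert_union, singleton_union]⟩

theorem pairwiseDisjoint_edit_split (hT : T.IsCompatible target.parts)
    (hP : (P : Set (Finset X)).PairwiseDisjoint id) (hC : C ∈ feasibleSplits target.parts P) :
    (edit T P (.split C) : Set (Finset X)).PairwiseDisjoint id := by
  obtain ⟨E, F, hs, hedit⟩ := exists_isSplit_edit_split hT hC
  rw [hedit]
  refine pairwiseDisjoint_insert_insert (hP.subset (coe_subset.2 (erase_subset C P))) hs.disjoint
    fun D hD => ?_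
  rw [hs.union_eq]
  exact hP (mem_filter.1 hC).1 (mem_of_mem_erase hD) (ne_of_mem_erase hD).symm

theorem overclusteringError_edit_split_add_one_le (hT : T.IsCompatible target.parts)
    (hC : C ∈ feasibleSplits target.parts P) :
    overclusteringError (edit T P (.split C)) target.parts + 1 ≤
      overclusteringError P target.parts := by
  obtain ⟨E, F, hs, hedit⟩ := exists_isSplit_edit_split hT hC
  have hparts := hs.clusterDist_add_add_one_le hT (not_subset_of_mem_feasibleSplits hC)
  have hinsert := overclusteringError_insert_insert_le E F (P.erase C) target.parts
  rw [hedit, ← insert_erase (mem_filter.1 hC).1, erase_insert_eq_erase, erase_idem,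
    overclusteringError_insert _ (notMem_erase C P)]
  omega

theorem totalPotential_edit_split (hT : T.IsCompatible target.parts)
    (hC : C ∈ feasibleSplits target.parts P) :
    totalPotential T target.parts (edit T P (.split C)) = totalPotential T target.parts P := by
  obtain ⟨E, F, hs, hedit⟩ := exists_isSplit_edit_split hT hC
  rw [hedit, hs.totalPotential_insert_insert hT (not_subset_of_mem_feasibleSplits hC),
    insert_erase (mem_filter.1 hC).1]

end SplitRequests

end Edits

/-! ### Histories -/

section Histories

theorem splitCount_add_mergeCount {X : Type*} (h : List (Request X)) :
    splitCount h + mergeCount h = h.length := by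
  induction h with
  | nil => rfl
  | cons r h ih =>
    cases r <;> simp only [splitCount, mergeCount, List.length_cons] <;> omega

variable {X : Type*} [DecidableEq X]

/-- An oracle for the unrestricted-merge model without a distributional assumption: as long as the
target has not been reached, all its requests are feasible. -/
def IsFeasibleOracle (T : LinkageTree X) (target P₀ : Finset (Finset X))
    (oracle : List (Request X) → PMF (Request X)) : Prop :=
  ∀ h : List (Request X), ValidHistory T target P₀ h → current T P₀ h ≠ target →
    ∀ r ∈ (oracle h).support, Feasible target (current T P₀ h) r

section Oracle

variable {T : LinkageTree X} {target P₀ : Finset (Finset X)}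
  {oracle : List (Request X) → PMF (Request X)} {h : List (Request X)}

theorem IsRandomMergeOracle.isFeasibleOracle (ho : IsRandomMergeOracle T target P₀ oracle) :
    IsFeasibleOracle T target P₀ oracle :=
  fun h hv hne => (ho h hv hne).1

theorem IsFeasibleOracle.exists_validHistory_cons (ho : IsFeasibleOracle T target P₀ oracle)
    (hv : ValidHistory T target P₀ h) (hne : current T P₀ h ≠ target) :
    ∃ r, ValidHistory T target P₀ (r :: h) := by
  obtain ⟨r, hr⟩ := (oracle h).support_nonempty
  exact ⟨r, hv, hne, ho h hv hne r hr⟩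

theorem IsFeasibleOracle.validHistory_of_mem_support_history
    (ho : IsFeasibleOracle T target P₀ oracle) {n : ℕ}
    (hh : h ∈ (history T target P₀ oracle n).support) :
    ValidHistory T target P₀ h ∧ (current T P₀ h = target ∨ h.length = n) := by
  induction n generalizing h with
  | zero =>
    rw [history, PMF.support_pure, Set.mem_singleton_iff] at hh
    subst hh
    exact ⟨trivial, Or.inr rfl⟩
  | succ n ih =>
    rw [history, PMF.mem_support_bind_iff] at hh
    obtain ⟨g, hg, hh⟩ := hh
    obtain ⟨hv, hg⟩ := ih hg
    by_cases hcurrent : current T P₀ g = target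
    · rw [if_pos hcurrent, PMF.support_pure, Set.mem_singleton_iff] at hh
      subst hh
      exact ⟨hv, Or.inl hcurrent⟩
    · rw [if_neg hcurrent, PMF.mem_support_map_iff] at hh
      obtain ⟨r, hr, rfl⟩ := hh
      refine ⟨⟨hv, hcurrent, ho g hv hcurrent r hr⟩, Or.inr ?_⟩
      rw [List.length_cons, hg.resolve_left hcurrent]

end Oracle

variable [Fintype X] {T : LinkageTree X} {target : Finpartition (univ : Finset X)}
  {P : Finset (Finset X)} {h : List (Request X)}

namespace ValidHistory

theorem pairwiseDisjoint_current (hv : ValidHistory T target.parts P h)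
    (hT : T.IsCompatible target.parts) (hP : (P : Set (Finset X)).PairwiseDisjoint id) :
    (current T P h : Set (Finset X)).PairwiseDisjoint id := by
  induction h with
  | nil => exact hP
  | cons r h ih =>
    obtain ⟨hv, -, hr⟩ := hv
    have hprev := ih hv
    cases r with
    | split C => exact pairwiseDisjoint_edit_split hT hprev hr
    | merge q =>
      obtain ⟨A, B, Q, rfl, hcurrent, hmerge⟩ := exists_isMergeable hprev hr
      rw [hcurrent] at hprev
      rw [current, hcurrent]
      exact hmerge.pairwiseDisjoint_edit hT
        (hprev.subset (coe_subset.2 ((subset_insert B Q).trans (subset_insert A _))))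

theorem splitCount_add_le (hv : ValidHistory T target.parts P h)
    (hT : T.IsCompatible target.parts) (hP : (P : Set (Finset X)).PairwiseDisjoint id) :
    splitCount h + overclusteringError (current T P h) target.parts ≤
      overclusteringError P target.parts := by
  induction h with
  | nil => exact (Nat.zero_add _).le
  | cons r h ih =>
    obtain ⟨hv, -, hr⟩ := hv
    have hprev := ih hv
    cases r with
    | split C =>
      have hedit := overclusteringError_edit_split_add_one_le hT hr
      rw [splitCount, current]
      omega
    | merge q =>
      obtain ⟨A, B, Q, rfl, hcurrent, hmerge⟩ :=
        exists_isMergeable (hv.pairwiseDisjoint_current hT hP) hr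
      rw [hcurrent] at hprev
      have hedit := hmerge.overclusteringError_edit_le hT
      rw [splitCount, current, hcurrent]
      omega

theorem two_mul_mergeCount_add_le (hv : ValidHistory T target.parts P h)
    (hT : T.IsCompatible target.parts) (hP : (P : Set (Finset X)).PairwiseDisjoint id) :
    2 * mergeCount h + totalPotential T target.parts (current T P h) ≤
      totalPotential T target.parts P := by
  induction h with
  | nil => exact (Nat.zero_add _).le
  | cons r h ih =>
    obtain ⟨hv, -, hr⟩ := hv
    have hprev := ih hv
    cases r with
    | split C =>
      have hedit := totalPotential_edit_split hT hr
      rw [mergeCount, current]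
      omega
    | merge q =>
      obtain ⟨A, B, Q, rfl, hcurrent, hmerge⟩ :=
        exists_isMergeable (hv.pairwiseDisjoint_current hT hP) hr
      rw [hcurrent] at hprev
      have hedit := hmerge.totalPotential_edit_add_two_le hT
      rw [mergeCount, current, hcurrent]
      omega

variable {initial : Finpartition (univ : Finset X)}

theorem splitCount_le (hv : ValidHistory T target.parts initial.parts h)
    (hT : T.IsCompatible target.parts) :
    splitCount h ≤ overclusteringError initial.parts target.parts :=
  le_of_add_le_left (hv.splitCount_add_le hT initial.supIndep.pairwiseDisjoint)

theorem mergeCount_le (hv : ValidHistory T target.parts initial.parts h)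
    (hT : T.IsCompatible target.parts) :
    mergeCount h ≤ 2 * underclusteringError initial.parts target.parts ^ 2 := by
  have hhistory := hv.two_mul_mergeCount_add_le hT initial.supIndep.pairwiseDisjoint
  have hinitial := totalPotential_le T target.parts initial.parts
  omega

end ValidHistory

theorem IsFeasibleOracle.current_eq {initial : Finpartition (univ : Finset X)}
    {oracle : List (Request X) → PMF (Request X)}
    (ho : IsFeasibleOracle T target.parts initial.parts oracle) (hT : T.IsCompatible target.parts)
    {n : ℕ} (hn : overclusteringError initial.parts target.parts +
      2 * underclusteringError initial.parts target.parts ^ 2 ≤ n)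
    (hh : h ∈ (history T target.parts initial.parts oracle n).support) :
    current T initial.parts h = target.parts := by
  obtain ⟨hv, hcurrent⟩ := ho.validHistory_of_mem_support_history hh
  by_contra hne
  have hlength : h.length = n := hcurrent.resolve_left hne
  obtain ⟨r, hr⟩ := ho.exists_validHistory_cons hv hne
  have hsplit := hr.splitCount_le hT
  have hmerge := hr.mergeCount_le hT
  have hcount := splitCount_add_mergeCount (r :: h)
  rw [List.length_cons] at hcount
  omega

end Histories

theorem two_mul_le_div_log_two_mul {x : ℝ} (hx : 2 ≤ x) {d : ℝ} (hd : 0 ≤ d) :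
    2 * d ≤ 2 / Real.log 2 * Real.log x * d := by
  have hlog : Real.log 2 ≤ Real.log x := Real.log_le_log two_pos hx
  have hpos : 0 < Real.log 2 := Real.log_pos one_lt_two
  refine mul_le_mul_of_nonneg_right ?_ hd
  rw [div_mul_eq_mul_div, le_div_iff₀ hpos]
  exact mul_le_mul_of_nonneg_left hlog zero_le_two

end InteractiveClustering

theorem theorem5_general {X : Type*} [Fintype X] [DecidableEq X] {S : X → X → ℝ}
    {target initial : Finpartition (Finset.univ : Finset X)} {T : LinkageTree X}
    {oracle : List (Request X) → PMF (Request X)} (hsymm : ∀ x y, S x y = S y x)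
    (hS : Stable S target.parts) (hT : IsAverageLinkageTree S T)
    (ho : IsFeasibleOracle T target.parts initial.parts oracle) {budget : ℝ}
    (hbudget : 2 * (underclusteringError initial.parts target.parts : ℝ) ^ 2 ≤ budget) {n : ℕ}
    (hn : (overclusteringError initial.parts target.parts : ℝ) + budget ≤ n) :
    (history T target.parts initial.parts oracle n).toOuterMeasure
      {h | current T initial.parts h = target.parts ∧
        splitCount h ≤ overclusteringError initial.parts target.parts ∧
        (mergeCount h : ℝ) ≤ budget} = 1 := by
  have hcompatible := hT.isCompatible hsymm hS
  have hlength : overclusteringError initial.parts target.parts +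
      2 * underclusteringError initial.parts target.parts ^ 2 ≤ n := by
    exact_mod_cast (add_le_add_right hbudget _).trans hn
  refine (PMF.toOuterMeasure_apply_eq_one_iff _ _).2 fun h hh => ?_
  obtain ⟨hv, -⟩ := ho.validHistory_of_mem_support_history hh
  have hmerge : (mergeCount h : ℝ) ≤
      2 * (underclusteringError initial.parts target.parts : ℝ) ^ 2 := by
    exact_mod_cast hv.mergeCount_le hcompatible
  exact ⟨ho.current_eq hcompatible hlength hh, hv.splitCount_le hcompatible, hmerge.trans hbudget⟩

theorem theorem5 :
    ∃ K : ℝ, 0 < K ∧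
      ∀ (X : Type*) [Fintype X] [DecidableEq X] (S : X → X → ℝ)
        (target initial : Finpartition (Finset.univ : Finset X))
        (T : LinkageTree X) (oracle : List (Request X) → PMF (Request X)) (ε : ℝ),
        (∀ x y, S x y = S y x) →
        Stable S target.parts →
        IsAverageLinkageTree S T →
        IsRandomMergeOracle T target.parts initial.parts oracle →
        0 < ε → ε < 1 → 2 ≤ (target.parts.card : ℝ) / ε →
        ∀ n : ℕ,
          (overclusteringError initial.parts target.parts : ℝ) +
            K * Real.log ((target.parts.card : ℝ) / ε) *
              (underclusteringError initial.parts target.parts : ℝ) ^ 2 ≤ (n : ℝ) →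
          1 - ε ≤ ((history T target.parts initial.parts oracle n).toOuterMeasure
            {h | current T initial.parts h = target.parts ∧
              splitCount h ≤ overclusteringError initial.parts target.parts ∧
              (mergeCount h : ℝ) ≤ K * Real.log ((target.parts.card : ℝ) / ε) *
                (underclusteringError initial.parts target.parts : ℝ) ^ 2}).toReal := by
  refine ⟨2 / Real.log 2, by positivity, fun X _ _ S _ _ T _ ε hsymm hS hT ho hε _ hk n hn => ?_⟩
  rw [theorem5_general hsymm hS hT ho.isFeasibleOracle
    (two_mul_le_div_log_two_mul hk (sq_nonneg _)) hn, ENNReal.toReal_one]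
  exact sub_le_self 1 hε.le
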